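/- Let $r,s\ge 0$ be integers, $N=r+s$, and let $X=[x_{i,j}]_{1\le i,j\le N}$ be a matrix of indeterminates, with Gauss decomposition $X=X_-X_0X_+$ over the field $\mathbb{C}(X)$ of rational functions in the $x_{i,j}$ ($X_-$ lower unitriangular, $X_0$ diagonal, $X_+$ upper unitriangular). For an integer $0\le r'\le N$ and partitions $\lambda,\mu$ contained in the rectangle with $r'$ rows and $N-r'$ columns, let $$S^{(r')}_{\lambda/\mu}(X):=\det\big[(X_+)_{i_a,j_b}\big]_{1\le a,b\le r'},\qquad i_a=\mu_{r'+1-a}+a,\quad j_b=\lambda_{r'+1-b}+b,$$ and $S^{(r')}_{\lambda}(X):=S^{(r')}_{\lambda/\varnothing}(X)$. Put $h^{(r')}_d(X):=S^{(r')}_{(d)}(X)$ and $e^{(r')}_d(X):=S^{(r')}_{(1^d)}(X)$ for $d\ge 0$, and $h^{(r')}_d(X)=e^{(r')}_d(X)=0$ for $d<0$. Let $\mu\subset\lambda$ be partitions with $\lambda$ contained in the rectangle $(s^r)$ ($r$ rows and $s$ columns). Write $\lambda=(\alpha\,|\,\beta)$ and $\mu=(\gamma\,|\,\delta)$ in Frobenius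 notation, that is, $\alpha_i=\lambda_i-i$, $\beta_i=\lambda'_i-i$ for $1\le i\le p$ and $\gamma_i=\mu_i-i$, $\delta_i=\mu'_i-i$ for $1\le i\le q$, where $p$ and $q$ are the numbers of diagonal boxes of $\lambda$ and $\mu$, and $\lambda',\mu'$ are the conjugate partitions. For integers $a,b\ge 0$ let $(a\,|\,b)=(a+1,1^b)$ be the hook. Then $$S^{(r)}_{\lambda/\mu}(X)=(-1)^q\det\left[\begin{array}{c|c}\left[S^{(r)}_{(\alpha_i|\beta_j)}(X)\right]_{1\le i\le p,\,1\le j\le p} & \left[h^{(r+\gamma_j+1)}_{\alpha_i-\gamma_j}(X)\right]_{1\le i\le p,\,1\le j\le q}\\[6pt]\hline \left[e^{(r-\delta_i-1)}_{\beta_j-\delta_i}(X)\right]_{1\le i\le q,\,1\le j\le p} & O_q\end{array}\right],$$ where $O_q$ is the $q\times q$ zero matrix. -/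

import Mathlib

open Matrix

namespace NinthSchur

/-! ### Gauss decomposition -/

section Gauss

/-- `U` is upper unitriangular. -/
def IsUpperUnitriangular {K : Type*} [Field K] {n : ℕ} (U : Matrix (Fin n) (Fin n) K) : Prop :=
  (∀ i j, j < i → U i j = 0) ∧ ∀ i, U i i = 1

/-- `L` is lower unitriangular. -/
def IsLowerUnitriangular {K : Type*} [Field K] {n : ℕ} (L : Matrix (Fin n) (Fin n) K) : Prop :=
  (∀ i j, i < j → L i j = 0) ∧ ∀ i, L i i = 1

/-- `X = L * diag(d) * U` is a Gauss decomposition of `X`. -/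
def IsGaussDecomposition {K : Type*} [Field K] {n : ℕ} (X L : Matrix (Fin n) (Fin n) K)
    (d : Fin n → K) (U : Matrix (Fin n) (Fin n) K) : Prop :=
  IsLowerUnitriangular L ∧ IsUpperUnitriangular U ∧ X = L * Matrix.diagonal d * U

/-- A matrix over a field all of whose leading principal minors are non-zero has a Gauss
decomposition. -/
theorem exists_isGaussDecomposition {K : Type*} [Field K] (n : ℕ) (X : Matrix (Fin n) (Fin n) K)
    (hX : ∀ (k : ℕ) (hk : k ≤ n),
      (X.submatrix (Fin.castLE hk) (Fin.castLE hk)).det ≠ 0) :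
    ∃ L d U, IsGaussDecomposition X L d U := by
  induction n with
  | zero =>
    exact ⟨1, 0, 1, ⟨fun i => i.elim0, fun i => i.elim0⟩, ⟨fun i => i.elim0, fun i => i.elim0⟩,
      by ext i; exact i.elim0⟩
  | succ n ih =>
    obtain ⟨L, d, U, ⟨hL0, hL1⟩, ⟨hU0, hU1⟩, hA⟩ := ih (X.submatrix Fin.castSucc Fin.castSucc) (by
      intro k hk
      have := hX k (hk.trans (Nat.le_succ n))
      rwa [Matrix.submatrix_submatrix])
    have hdet : (X.submatrix Fin.castSucc Fin.castSucc).det ≠ 0 := hX n (Nat.le_succ n)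
    have hLD : IsUnit (L * Matrix.diagonal d).det := by
      rw [hA, Matrix.det_mul] at hdet
      exact isUnit_iff_ne_zero.2 (left_ne_zero_of_mul hdet)
    have hDU : IsUnit (Matrix.diagonal d * U).det := by
      rw [hA, Matrix.mul_assoc, Matrix.det_mul] at hdet
      exact isUnit_iff_ne_zero.2 (right_ne_zero_of_mul hdet)
    obtain ⟨u, hu⟩ : ∃ u : Fin n → K,
        (L * Matrix.diagonal d) *ᵥ u = fun i => X i.castSucc (Fin.last n) :=
      ⟨(L * Matrix.diagonal d)⁻¹ *ᵥ fun i => X i.castSucc (Fin.last n), by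
        rw [Matrix.mulVec_mulVec, Matrix.mul_nonsing_inv _ hLD, Matrix.one_mulVec]⟩
    obtain ⟨l, hl⟩ : ∃ l : Fin n → K,
        l ᵥ* (Matrix.diagonal d * U) = fun j => X (Fin.last n) j.castSucc :=
      ⟨(fun j => X (Fin.last n) j.castSucc) ᵥ* (Matrix.diagonal d * U)⁻¹, by
        rw [Matrix.vecMul_vecMul, Matrix.nonsing_inv_mul _ hDU, Matrix.vecMul_one]⟩
    refine ⟨Matrix.of fun i j => Fin.lastCases (motive := fun _ => K)
        (Fin.lastCases (motive := fun _ => K) 1 l j)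
        (fun i => Fin.lastCases (motive := fun _ => K) 0 (L i) j) i,
      Fin.lastCases (motive := fun _ => K)
        (X (Fin.last n) (Fin.last n) - ∑ k, l k * d k * u k) d,
      Matrix.of fun i j => Fin.lastCases (motive := fun _ => K)
        (Fin.lastCases (motive := fun _ => K) 1 (fun _ => 0) j)
        (fun i => Fin.lastCases (motive := fun _ => K) (u i) (U i) j) i,
      ⟨?_, ?_⟩, ⟨?_, ?_⟩, ?_⟩
    · intro i j hij
      induction i using Fin.lastCases with
      | last => exact absurd hij (not_lt.2 (Fin.le_last j))
      | cast i =>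
        induction j using Fin.lastCases with
        | last => simp
        | cast j => simpa using hL0 i j (by simpa using hij)
    · intro i
      induction i using Fin.lastCases with
      | last => simp
      | cast i => simpa using hL1 i
    · intro i j hij
      induction j using Fin.lastCases with
      | last => exact absurd hij (not_lt.2 (Fin.le_last i))
      | cast j =>
        induction i using Fin.lastCases with
        | last => simp
        | cast i => simpa using hU0 i j (by simpa using hij)
    · intro i
      induction i using Fin.lastCases with
      | last => simp
      | cast i => simpa using hU1 i
    · ext i j
      rw [Matrix.mul_apply]
      simp only [Matrix.mul_diagonal]
      rw [Fin.sum_univ_castSucc]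
      induction i using Fin.lastCases with
      | last =>
        induction j using Fin.lastCases with
        | last => simp
        | cast j =>
          have := congrFun hl j
          simp only [Matrix.vecMul, dotProduct, Matrix.diagonal_mul] at this
          simp [← this, mul_assoc]
      | cast i =>
        induction j using Fin.lastCases with
        | last =>
          have := congrFun hu i
          simp only [Matrix.mulVec, dotProduct, Matrix.mul_diagonal] at this
          simp [← this]
        | cast j =>
          have := congrFun (congrFun hA i) j
          rw [Matrix.mul_apply] at this
          simp only [Matrix.mul_diagonal, Matrix.submatrix_apply] at this
          simp [this]

/-- The Gauss decomposition of an invertible matrix is unique. -/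
theorem IsGaussDecomposition.unique {K : Type*} [Field K] {n : ℕ}
    {X L₁ L₂ U₁ U₂ : Matrix (Fin n) (Fin n) K} {d₁ d₂ : Fin n → K} (hX : X.det ≠ 0)
    (h₁ : IsGaussDecomposition X L₁ d₁ U₁) (h₂ : IsGaussDecomposition X L₂ d₂ U₂) :
    U₁ = U₂ := by
  obtain ⟨⟨a₁, b₁⟩, ⟨u₁, v₁⟩, e₁⟩ := h₁
  obtain ⟨⟨a₂, b₂⟩, ⟨u₂, v₂⟩, e₂⟩ := h₂
  have hLD : IsUnit (L₁ * Matrix.diagonal d₁).det := by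
    rw [e₁, Matrix.det_mul] at hX
    exact isUnit_iff_ne_zero.2 (left_ne_zero_of_mul hX)
  have hU : IsUnit U₂.det := by
    rw [e₂, Matrix.det_mul] at hX
    exact isUnit_iff_ne_zero.2 (right_ne_zero_of_mul hX)
  have tU₁ : U₁.BlockTriangular id := fun i j hij => u₁ i j hij
  have tU₂ : U₂.BlockTriangular id := fun i j hij => u₂ i j hij
  have tL₁ : L₁.BlockTriangular OrderDual.toDual := fun i j hij => a₁ i j hij
  have tL₂ : L₂.BlockTriangular OrderDual.toDual := fun i j hij => a₂ i j hij
  have := Matrix.invertibleOfIsUnitDet _ hLD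
  have := Matrix.invertibleOfIsUnitDet _ hU
  have tLD₁ := Matrix.blockTriangular_inv_of_blockTriangular
    (tL₁.mul (Matrix.blockTriangular_diagonal d₁))
  have tLD₂ := tL₂.mul (Matrix.blockTriangular_diagonal d₂)
  have hW : U₁ * U₂⁻¹ = (L₁ * Matrix.diagonal d₁)⁻¹ * (L₂ * Matrix.diagonal d₂) := by
    have e : U₁ = (L₁ * Matrix.diagonal d₁)⁻¹ * (L₂ * Matrix.diagonal d₂ * U₂) := by
      rw [← e₂, e₁, ← Matrix.mul_assoc, Matrix.nonsing_inv_mul _ hLD, Matrix.one_mul]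
    conv_lhs => rw [e]
    rw [Matrix.mul_assoc, Matrix.mul_assoc (L₂ * Matrix.diagonal d₂),
      Matrix.mul_nonsing_inv _ hU, Matrix.mul_one]
  have tW : (U₁ * U₂⁻¹).BlockTriangular id :=
    tU₁.mul (Matrix.blockTriangular_inv_of_blockTriangular tU₂)
  have tW' : (U₁ * U₂⁻¹).BlockTriangular OrderDual.toDual := by
    rw [hW]; exact tLD₁.mul tLD₂
  have hdiag : U₁ * U₂⁻¹ = Matrix.diagonal fun i => (U₁ * U₂⁻¹) i i := by
    ext i j
    rcases lt_trichotomy i j with h | rfl | h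
    · rw [Matrix.diagonal_apply_ne _ h.ne]; exact tW' h
    · simp
    · rw [Matrix.diagonal_apply_ne _ h.ne']; exact tW h
  have hWU : U₁ = Matrix.diagonal (fun i => (U₁ * U₂⁻¹) i i) * U₂ := by
    rw [← hdiag, Matrix.mul_assoc, Matrix.nonsing_inv_mul _ hU, Matrix.mul_one]
  have hone : ∀ i, (U₁ * U₂⁻¹) i i = 1 := by
    intro i
    have := congrFun (congrFun hWU i) i
    rwa [Matrix.diagonal_mul, v₁, v₂, mul_one, eq_comm] at this
  rw [hWU]
  simp [hone]

end Gauss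

/-! ### The generic matrix and its upper unitriangular Gauss factor -/

section Generic

/-- The field `ℂ(X)` of rational functions in the indeterminates `x_{i,j}`, `1 ≤ i, j ≤ N`. -/
abbrev RatFun (N : ℕ) : Type := FractionRing (MvPolynomial (Fin N × Fin N) ℂ)

/-- The `N × N` matrix `X = [x_{i,j}]` of indeterminates, over `ℂ(X)`. -/
noncomputable def genericMatrix (N : ℕ) : Matrix (Fin N) (Fin N) (RatFun N) :=
  (Matrix.mvPolynomialX (Fin N) (Fin N) ℂ).map
    (algebraMap (MvPolynomial (Fin N × Fin N) ℂ) (RatFun N))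

theorem det_submatrix_genericMatrix_ne_zero (N k : ℕ) (hk : k ≤ N) :
    ((genericMatrix N).submatrix (Fin.castLE hk) (Fin.castLE hk)).det ≠ 0 := by
  have h : ((Matrix.mvPolynomialX (Fin N) (Fin N) ℂ).submatrix
      (Fin.castLE hk) (Fin.castLE hk)).det ≠ 0 := by
    intro h0
    have h1 := congrArg (MvPolynomial.eval fun p : Fin N × Fin N =>
      (1 : Matrix (Fin N) (Fin N) ℂ) p.1 p.2) h0
    rw [RingHom.map_det, map_zero] at h1
    have h2 : (MvPolynomial.eval fun p : Fin N × Fin N =>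
        (1 : Matrix (Fin N) (Fin N) ℂ) p.1 p.2).mapMatrix
        ((Matrix.mvPolynomialX (Fin N) (Fin N) ℂ).submatrix (Fin.castLE hk) (Fin.castLE hk))
        = 1 := by
      ext i j
      simp [Matrix.one_apply]
    rw [h2, Matrix.det_one] at h1
    exact one_ne_zero h1
  intro h0
  apply h
  apply IsFractionRing.injective (MvPolynomial (Fin N × Fin N) ℂ) (RatFun N)
  rw [RingHom.map_det, map_zero, ← h0]
  rfl

theorem exists_isGaussDecomposition_genericMatrix (N : ℕ) :
    ∃ U L d, IsGaussDecomposition (genericMatrix N) L d U := by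
  obtain ⟨L, d, U, h⟩ := exists_isGaussDecomposition N (genericMatrix N)
    (det_submatrix_genericMatrix_ne_zero N)
  exact ⟨U, L, d, h⟩

/-- The upper unitriangular factor `X₊` in the Gauss decomposition `X = X₋ X₀ X₊` of the matrix
of indeterminates. -/
noncomputable def upperFactor (N : ℕ) : Matrix (Fin N) (Fin N) (RatFun N) :=
  (exists_isGaussDecomposition_genericMatrix N).choose

/-- `upperFactor N` is the only matrix that occurs as the upper unitriangular factor in a Gauss
decomposition of the matrix of indeterminates. -/
theorem eq_upperFactor_iff (N : ℕ) (U : Matrix (Fin N) (Fin N) (RatFun N)) :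
    U = upperFactor N ↔ ∃ L d, IsGaussDecomposition (genericMatrix N) L d U := by
  obtain ⟨L, d, h⟩ := (exists_isGaussDecomposition_genericMatrix N).choose_spec
  constructor
  · rintro rfl
    exact ⟨L, d, h⟩
  · rintro ⟨L', d', h'⟩
    exact h'.unique (det_submatrix_genericMatrix_ne_zero N N le_rfl) h

end Generic

/-! ### Partitions

Partitions are Young diagrams; `lam.rowLen i` is the part `λ_{i+1}` and `lam.colLen j` is the part
`λ'_{j+1}` of the conjugate partition (indices start at `0` in the code). -/

section Partitions

/-- `λ` is contained in the rectangle `(s^r)` with `r` rows and `s` columns. -/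
def InRectangle (lam : YoungDiagram) (r s : ℕ) : Prop :=
  lam.colLen 0 ≤ r ∧ lam.rowLen 0 ≤ s

/-- The hook `(a | b) = (a + 1, 1^b)`. -/
def hook (a b : ℕ) : YoungDiagram :=
  YoungDiagram.ofRowLens ((a + 1) :: List.replicate b 1) (by
    rw [List.sortedGE_iff_pairwise, List.pairwise_cons]
    refine ⟨fun x hx => ?_, List.pairwise_replicate.2 (Or.inr le_rfl)⟩
    rw [List.eq_of_mem_replicate hx]
    omega)

/-- The one-row partition `(d)`. -/
def oneRow (d : ℕ) : YoungDiagram :=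
  YoungDiagram.ofRowLens [d] (by simp [List.sortedGE_iff_pairwise])

/-- The one-column partition `(1^d)`. -/
def oneColumn (d : ℕ) : YoungDiagram :=
  YoungDiagram.ofRowLens (List.replicate d 1) (by
    rw [List.sortedGE_iff_pairwise]
    exact List.pairwise_replicate.2 (Or.inr le_rfl))

/-- The number of diagonal boxes of `λ`. -/
def diagLength (lam : YoungDiagram) : ℕ :=
  (lam.cells.filter fun c => c.1 = c.2).card

/-- The Frobenius coordinate `α_{i+1} = λ_{i+1} - (i+1)`, used for `i < diagLength lam`, where the
subtraction does not truncate. -/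
def arm (lam : YoungDiagram) (i : ℕ) : ℕ := lam.rowLen i - (i + 1)

/-- The Frobenius coordinate `β_{i+1} = λ'_{i+1} - (i+1)`, used for `i < diagLength lam`, where the
subtraction does not truncate. -/
def leg (lam : YoungDiagram) (i : ℕ) : ℕ := lam.colLen i - (i + 1)

/-- The Maya diagram of `λ`: for `a = 1, …, r` its `a`-th element is `λ_{r+1-a} + a`. With `a` and
the elements both counted from `0` this is the formula below. -/
def maya (N r : ℕ) (lam : YoungDiagram) (h : r ≤ N ∧ InRectangle lam r (N - r)) (a : Fin r) :
    Fin N :=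
  ⟨lam.rowLen a.rev + a, by
    have h1 := lam.rowLen_anti 0 a.rev (Nat.zero_le _)
    have h2 := h.1
    have h3 := h.2.2
    have h4 := a.isLt
    omega⟩

end Partitions

/-! ### Ninth variation of skew Schur functions -/

section Schur

open Classical in
/-- The ninth variation `S^{(r)}_{λ/μ}(X) = ξ^I_J(X₊)` of the skew Schur function for the `N × N`
matrix `X` of indeterminates, where `I` and `J` are the Maya diagrams of `μ` and `λ`. It is
defined for `r ≤ N` and `λ, μ` contained in the rectangle `((N-r)^r)`; the value `0` outside this
range is a placeholder. -/
noncomputable def schur (N r : ℕ) (lam mu : YoungDiagram) : RatFun N :=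
  if h : (r ≤ N ∧ InRectangle lam r (N - r)) ∧ (r ≤ N ∧ InRectangle mu r (N - r)) then
    ((upperFactor N).submatrix (maya N r mu h.2) (maya N r lam h.1)).det
  else 0

/-- `h^{(r)}_d(X) = S^{(r)}_{(d)}(X)` for `d ≥ 0`, and `0` for `d < 0`. -/
noncomputable def hFun (N r : ℕ) (d : ℤ) : RatFun N :=
  if d < 0 then 0 else schur N r (oneRow d.toNat) ⊥

/-- `e^{(r)}_d(X) = S^{(r)}_{(1^d)}(X)` for `d ≥ 0`, and `0` for `d < 0`. -/
noncomputable def eFun (N r : ℕ) (d : ℤ) : RatFun N :=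
  if d < 0 then 0 else schur N r (oneColumn d.toNat) ⊥

/-- The Giambelli block matrix `G^{(r)}_{λ/μ}(X)` of size `p + q`, where `λ = (α | β)` has `p` and
`μ = (γ | δ)` has `q` diagonal boxes. For `μ ⊆ λ ⊆ ((N-r)^r)` one has `δ_i + 1 ≤ r`, so the
subtraction of natural numbers in the lower left block does not truncate. -/
noncomputable def giambelliMatrix (N r : ℕ) (lam mu : YoungDiagram) :
    Matrix (Fin (diagLength lam) ⊕ Fin (diagLength mu))
      (Fin (diagLength lam) ⊕ Fin (diagLength mu)) (RatFun N) :=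
  Matrix.fromBlocks
    (Matrix.of fun i j => schur N r (hook (arm lam i) (leg lam j)) ⊥)
    (Matrix.of fun i j => hFun N (r + arm mu j + 1) ((arm lam i : ℤ) - (arm mu j : ℤ)))
    (Matrix.of fun i j => eFun N (r - (leg mu i + 1)) ((leg lam j : ℤ) - (leg mu i : ℤ)))
    0

end Schur

end NinthSchur

/-! Write U for the upper unitriangular factor and A for its leading r × r block, so det A = 1. The
skew function is the minor of U with rows at the beads of μ and columns at the beads of λ. Counted
from 0, the beads of λ are 0, …, r-1 with the places r-1-β_i vacated and the places r+α_i filled.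
Listing the bead r+α_i at the vacated place r-1-β_i costs the sign ∏ (-1)^{β_i}
(`det_submatrix_beads`), and likewise for μ.

The minor is then det A with p columns and q rows exchanged. Two Schur complements of one bordered
matrix (`det_add_rank_update`, `det_submatrix_extend`) turn it into (-1)^q times a determinant of
size p + q with blocks taken from A⁻¹U, A⁻¹ and U. The zero block reflects that a row exchange and a
column exchange meet only through U.

These blocks are the Giambelli blocks up to signs and a transposition: the case p = 1, q = 0
identifies entries of A⁻¹U with hooks (`det_beads_hook`), entries of U are the h's
(`det_beads_oneRow`), and entries of A⁻¹ are signed e's (`det_beads_oneColumn`). The row and column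
signs cancel those from sorting the beads, leaving (-1)^q. -/

open Matrix

namespace NinthSchur

/-! ### Minors after exchanging rows and columns. -/

section Replacement

variable {m p q K ι : Type*} [Fintype m] [DecidableEq m] [Fintype p] [DecidableEq p]
  [Fintype q] [DecidableEq q] [Field K]

/-- A determinant identity obtained by comparing two Schur complements in one bordered matrix. -/
theorem det_add_rank_update (A : Matrix m m K) (hA : IsUnit A.det) (B : Matrix m p K)
    (D : Matrix q p K) (E : Matrix m p K) (E' : Matrix p m K) (F : Matrix m q K)
    (F' : Matrix q m K) (hE : E' * E = 1) (hF : F' * F = 1) :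
    (A + (B - A * E) * E' + F * (D * E' - F' * (A + (B - A * E) * E'))).det =
      A.det * (fromBlocks (E' * A⁻¹ * B) (E' * A⁻¹ * F) (-D) 0).det := by
  set Y := B - A * E with hY
  set C := D - F' * Y with hC
  let := A.invertibleOfIsUnitDet hA
  -- The corner `C` is chosen so that `C + F' * Y = D`, which is the lower left block left over
  -- after eliminating `A`.
  let L : Matrix (p ⊕ q) (p ⊕ q) K := fromBlocks (-1) 0 C (-1)
  let L' : Matrix (p ⊕ q) (p ⊕ q) K := fromBlocks (-1) 0 (-C) (-1)
  have hLL' : L * L' = 1 := by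
    simp [L, L', fromBlocks_multiply]
  have hL'L : L' * L = 1 := by
    simp [L, L', fromBlocks_multiply]
  let : Invertible L := ⟨L', hL'L, hLL'⟩
  have hLinv : ⅟L = L' := rfl
  have hLdet : L.det = (-1) ^ Fintype.card (p ⊕ q) := by
    simp [L, det_neg, pow_add]
  -- Eliminating `A` from `Z` leaves the determinant of size p + q; eliminating `L` leaves the
  -- updated matrix of the size of `A`.
  let Z := fromBlocks A (fromCols Y F) (fromRows E' (-(F' * A))) L
  have h1 : Z.det = A.det * ((-1) ^ Fintype.card (p ⊕ q) *
      (fromBlocks (E' * A⁻¹ * B) (E' * A⁻¹ * F) (-D) 0).det) := by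
    rw [det_fromBlocks₁₁, ← det_neg]
    congr 2
    rw [invOf_eq_nonsing_inv, fromRows_mul, fromRows_mul_fromCols, fromBlocks_neg,
      sub_eq_add_neg, fromBlocks_neg, fromBlocks_add]
    have e1 : E' * A⁻¹ * Y = E' * A⁻¹ * B - 1 := by
      rw [hY, Matrix.mul_sub, Matrix.mul_assoc E' A⁻¹ (A * E), ← Matrix.mul_assoc A⁻¹,
        nonsing_inv_mul _ hA, Matrix.one_mul, hE]
    have e2 : -(F' * A) * A⁻¹ = -F' := by
      rw [Matrix.neg_mul, Matrix.mul_assoc, mul_nonsing_inv _ hA, Matrix.mul_one]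
    rw [e1, e2]
    congr 1
    · abel
    · simp
    · simp [hC]
    · simp [hF]
  have h2 : Z.det = (-1) ^ Fintype.card (p ⊕ q) *
      (A + Y * E' + F * (D * E' - F' * (A + Y * E'))).det := by
    rw [det_fromBlocks₂₂, hLdet, hLinv]
    congr 2
    rw [Matrix.mul_assoc, fromBlocks_mul_fromRows, fromCols_mul_fromRows]
    simp only [hC, Matrix.mul_sub, Matrix.sub_mul, Matrix.mul_add, Matrix.mul_neg,
      Matrix.neg_mul, Matrix.mul_assoc, Matrix.zero_mul, Matrix.mul_zero, Matrix.one_mul]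
    abel
  have h3 : ((-1 : K) ^ Fintype.card (p ⊕ q)) ≠ 0 := pow_ne_zero _ (by simp)
  apply mul_left_cancel₀ h3
  rw [← h2, h1]
  ring

theorem one_submatrix_id_mul {n k m K : Type*} [Fintype m] [DecidableEq m] [Field K]
    (S : n → m) (N : Matrix m k K) :
    (1 : Matrix m m K).submatrix S id * N = N.submatrix S id := by
  ext i j
  simp [Matrix.mul_apply, Matrix.one_apply]

theorem mul_one_submatrix_id {n k m K : Type*} [Fintype m] [DecidableEq m] [Field K]
    (S : n → m) (N : Matrix k m K) :
    N * (1 : Matrix m m K).submatrix id S = N.submatrix id S := by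
  ext i j
  simp [Matrix.mul_apply, Matrix.one_apply]

/-- The minor of `U` whose index families arise from `f` by replacing the entries at the places
`P` by `Q` and at the places `R` by `T`. -/
theorem det_submatrix_extend (U : Matrix ι ι K) (f : m → ι) (hA : IsUnit (U.submatrix f f).det)
    {R : p → m} (hR : R.Injective) (T : p → ι) {P : q → m} (hP : P.Injective) (Q : q → ι)
    (hQ : U.submatrix Q f = 0) :
    (U.submatrix (Function.extend P Q f) (Function.extend R T f)).det =
      (U.submatrix f f).det * ((-1) ^ Fintype.card q *
        (fromBlocks (((U.submatrix f f)⁻¹ * U.submatrix f T).submatrix R id)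
          ((U.submatrix f f)⁻¹.submatrix R P) (U.submatrix Q T) 0).det) := by
  set A := U.submatrix f f
  -- With these 0-1 selection matrices the first correction overwrites the columns `R` of `A`, and
  -- the second overwrites the rows `P` of the result.
  have key := det_add_rank_update A hA (U.submatrix f T) (U.submatrix Q T)
    ((1 : Matrix m m K).submatrix id R) ((1 : Matrix m m K).submatrix R id)
    ((1 : Matrix m m K).submatrix id P) ((1 : Matrix m m K).submatrix P id)
    (by rw [one_submatrix_id_mul, submatrix_submatrix]; exact submatrix_one _ hR)
    (by rw [one_submatrix_id_mul, submatrix_submatrix]; exact submatrix_one _ hP)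
  have hsign : (fromBlocks ((1 : Matrix m m K).submatrix R id * A⁻¹ * U.submatrix f T)
      ((1 : Matrix m m K).submatrix R id * A⁻¹ * (1 : Matrix m m K).submatrix id P)
      (-U.submatrix Q T) 0).det = (-1) ^ Fintype.card q *
        (fromBlocks ((A⁻¹ * U.submatrix f T).submatrix R id)
          (A⁻¹.submatrix R P) (U.submatrix Q T) 0).det := by
    have : fromBlocks ((1 : Matrix m m K).submatrix R id * A⁻¹ * U.submatrix f T)
        ((1 : Matrix m m K).submatrix R id * A⁻¹ * (1 : Matrix m m K).submatrix id P)
        (-U.submatrix Q T) 0 = fromBlocks 1 0 0 (-1) *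
        fromBlocks ((A⁻¹ * U.submatrix f T).submatrix R id)
          (A⁻¹.submatrix R P) (U.submatrix Q T) 0 := by
      rw [Matrix.mul_assoc, one_submatrix_id_mul, mul_one_submatrix_id, one_submatrix_id_mul,
        submatrix_submatrix, fromBlocks_multiply]
      simp
    rw [this, det_mul]
    simp [det_neg]
  rw [← hsign, ← key]
  congr 1
  have hcol : ∀ (N : Matrix m p K) (a b : m), (N * (1 : Matrix m m K).submatrix R id) a b =
      ∑ i, if R i = b then N a i else 0 := by
    intro N a b
    simp [Matrix.mul_apply, Matrix.one_apply]
  have hX : A + (U.submatrix f T - A * (1 : Matrix m m K).submatrix id R) *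
      (1 : Matrix m m K).submatrix R id = U.submatrix f (Function.extend R T f) := by
    ext a b
    rw [mul_one_submatrix_id, Matrix.add_apply, hcol]
    by_cases hb : ∃ i, R i = b
    · obtain ⟨i, rfl⟩ := hb
      simp [hR.extend_apply, hR.eq_iff, A]
    · rw [submatrix_apply _ _ _ a b, Function.extend_apply' _ _ _ hb]
      push Not at hb
      simp [hb, A]
  rw [hX]
  -- By `hQ` a new row vanishes at every column that is not replaced, so spreading its entries at
  -- `T` by zeros gives the whole row.
  have hDE : U.submatrix Q T * (1 : Matrix m m K).submatrix R id =
      U.submatrix Q (Function.extend R T f) := by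
    ext a b
    rw [Matrix.mul_apply, submatrix_apply]
    by_cases hb : ∃ i, R i = b
    · obtain ⟨i, rfl⟩ := hb
      simp [hR.extend_apply, Matrix.one_apply, hR.eq_iff]
    · rw [Function.extend_apply' _ _ _ hb]
      push Not at hb
      simpa [hb, Matrix.one_apply] using (congrFun (congrFun hQ a) b).symm
  rw [hDE, one_submatrix_id_mul, submatrix_submatrix]
  ext a b
  rw [Matrix.add_apply, Matrix.mul_apply]
  by_cases ha : ∃ i, P i = a
  · obtain ⟨i, rfl⟩ := ha
    simp [hP.extend_apply, Matrix.one_apply, hP.eq_iff]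
  · rw [submatrix_apply, Function.extend_apply' _ _ _ ha]
    push Not at ha
    simp [fun x => (ha x).symm]

end Replacement

/-! ### Signs of rearrangements. -/

section Sorting

/-- Passing from a strictly increasing family of column indices to a rearrangement of it. -/
theorem det_submatrix_rearrange {K : Type*} [CommRing K] {r : ℕ} (G : Matrix (Fin r) ℕ K)
    {f c : Fin r → ℕ} (hf : StrictMono f) (hc : c.Injective) (hcf : ∀ k, c k ∈ Set.range f) :
    (G.submatrix id f).det =
      (∏ i, ∏ j ∈ Finset.Ioi i, if c i < c j then 1 else -1) * (G.submatrix id c).det := by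
  choose g hg using hcf
  have hinj : g.Injective := fun a b h => hc (by rw [← hg, ← hg, h])
  let σ : Equiv.Perm (Fin r) := Equiv.ofBijective g (Finite.injective_iff_bijective.1 hinj)
  have hσ : ∀ k, f (σ k) = c k := hg
  have h1 : G.submatrix id c = (G.submatrix id f).submatrix id σ := by
    ext a b
    simp [hσ]
  -- As `f` is increasing, the inversions of `σ` are those of `c`.
  have h2 : ((Equiv.Perm.sign σ : ℤ) : K) =
      ∏ i, ∏ j ∈ Finset.Ioi i, if c i < c j then 1 else -1 := by
    rw [Equiv.Perm.sign_eq_prod_prod_Ioi]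
    push_cast
    refine Finset.prod_congr rfl fun i _ => Finset.prod_congr rfl fun j _ => ?_
    simp only [← hσ, hf.lt_iff_lt]
    split_ifs <;> simp
  rw [h1, det_permute', ← h2, ← mul_assoc, ← Int.cast_mul, ← Units.val_mul, Int.units_mul_self]
  simp

/-- The inversion sign of the identity with its entries at the places `R` replaced by large
values, in reverse order. -/
theorem prod_inversions_extend {K : Type*} [CommRing K] {r p : ℕ} {R : Fin p → Fin r}
    (hR : StrictMono R) {T : Fin p → ℕ} (hT : StrictAnti T) (hTr : ∀ i, r ≤ T i) :
    (∏ i, ∏ j ∈ Finset.Ioi i, if Function.extend R T Fin.val i < Function.extend R T Fin.val j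
      then (1 : K) else -1) = ∏ i, (-1) ^ (r - 1 - (R i : ℕ)) := by
  classical
  have h1 : ∀ i : Fin r, (∏ j ∈ Finset.Ioi i,
      if Function.extend R T Fin.val i < Function.extend R T Fin.val j then (1 : K) else -1) =
      if i ∈ Finset.univ.image R then (-1) ^ (r - 1 - (i : ℕ)) else 1 := by
    intro i
    -- A replaced place is inverted with every later place: later replaced values are smaller, and
    -- the others are below `r`. An unreplaced place is inverted with no later one.
    split_ifs with hi
    · obtain ⟨a, -, rfl⟩ := Finset.mem_image.1 hi
      rw [← Fin.card_Ioi, ← Finset.prod_const]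
      refine Finset.prod_congr rfl fun j hj => if_neg ?_
      rw [hR.injective.extend_apply, not_lt]
      by_cases hb : ∃ b, R b = j
      · obtain ⟨b, rfl⟩ := hb
        rw [hR.injective.extend_apply]
        exact (hT (hR.lt_iff_lt.1 (Finset.mem_Ioi.1 hj))).le
      · rw [Function.extend_apply' _ _ _ hb]
        exact j.isLt.le.trans (hTr a)
    · have hi' : ¬ ∃ a, R a = i := by simpa using hi
      refine Finset.prod_eq_one fun j hj => if_pos ?_
      rw [Function.extend_apply' _ _ _ hi']
      by_cases hb : ∃ b, R b = j
      · obtain ⟨b, rfl⟩ := hb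
        rw [hR.injective.extend_apply]
        exact i.isLt.trans_le (hTr b)
      · rw [Function.extend_apply' _ _ _ hb]
        exact Fin.lt_def.1 (Finset.mem_Ioi.1 hj)
  rw [Finset.prod_congr rfl fun i _ => h1 i, Finset.prod_ite_mem, Finset.univ_inter,
    Finset.prod_image hR.injective.injOn]

end Sorting

/-! ### Beads and Frobenius coordinates. -/

section Frobenius

theorem lt_diagLength_iff {lam : YoungDiagram} {i : ℕ} : i < diagLength lam ↔ (i, i) ∈ lam := by
  classical
  obtain ⟨n, hn⟩ : ∃ n, (n, n) ∉ lam := by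
    obtain ⟨j, hj⟩ := lam.exists_notMem_row 0
    exact ⟨j, fun h => hj (lam.up_left_mem (Nat.zero_le _) le_rfl h)⟩
  have hex : ∃ n, (n, n) ∉ lam := ⟨n, hn⟩
  have hiff : ∀ i, (i, i) ∈ lam ↔ i < Nat.find hex := by
    intro i
    rw [Nat.lt_find_iff]
    push Not
    exact ⟨fun h k hk => lam.up_left_mem hk hk h, fun h => h i le_rfl⟩
  have hcells : lam.cells.filter (fun c => c.1 = c.2) =
      (Finset.range (Nat.find hex)).image fun i => (i, i) := by
    ext ⟨a, b⟩
    simp only [Finset.mem_filter, YoungDiagram.mem_cells, Finset.mem_image, Finset.mem_range,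
      Prod.mk.injEq, ← hiff]
    constructor
    · rintro ⟨h, rfl⟩
      exact ⟨a, h, rfl, rfl⟩
    · rintro ⟨i, h, rfl, rfl⟩
      exact ⟨h, rfl⟩
  rw [hiff, diagLength, hcells, Finset.card_image_of_injective _ fun a b h => congrArg Prod.fst h,
    Finset.card_range]

theorem lt_rowLen_of_lt_diagLength {lam : YoungDiagram} {i : ℕ} (h : i < diagLength lam) :
    i < lam.rowLen i :=
  YoungDiagram.mem_iff_lt_rowLen.1 (lt_diagLength_iff.1 h)

theorem lt_colLen_of_lt_diagLength {lam : YoungDiagram} {i : ℕ} (h : i < diagLength lam) :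
    i < lam.colLen i :=
  YoungDiagram.mem_iff_lt_colLen.1 (lt_diagLength_iff.1 h)

theorem leg_lt {lam : YoungDiagram} {r i : ℕ} (hr : lam.colLen 0 ≤ r) (h : i < diagLength lam) :
    leg lam i < r := by
  have h1 := lt_colLen_of_lt_diagLength h
  have h2 := lam.colLen_anti 0 i (Nat.zero_le _)
  unfold leg
  omega

theorem arm_lt {lam : YoungDiagram} {s i : ℕ} (hs : lam.rowLen 0 ≤ s) (h : i < diagLength lam) :
    arm lam i < s := by
  have h1 := lt_rowLen_of_lt_diagLength h
  have h2 := lam.rowLen_anti 0 i (Nat.zero_le _)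
  unfold arm
  omega

theorem leg_lt_leg {lam : YoungDiagram} {i j : ℕ} (hij : i < j) (h : j < diagLength lam) :
    leg lam j < leg lam i := by
  have h1 := lt_colLen_of_lt_diagLength h
  have h2 := lam.colLen_anti i j hij.le
  unfold leg
  omega

theorem arm_lt_arm {lam : YoungDiagram} {i j : ℕ} (hij : i < j) (h : j < diagLength lam) :
    arm lam j < arm lam i := by
  have h1 := lt_rowLen_of_lt_diagLength h
  have h2 := lam.rowLen_anti i j hij.le
  unfold arm
  omega

/-- The elements of the Maya diagram of `λ` with `r` beads, as natural numbers. -/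
def beads (r : ℕ) (lam : YoungDiagram) (a : Fin r) : ℕ := lam.rowLen a.rev + a

theorem beads_strictMono (r : ℕ) (lam : YoungDiagram) : StrictMono (beads r lam) := by
  intro a b hab
  have h := lam.rowLen_anti b.rev a.rev (Fin.rev_le_rev.2 hab.le)
  have h' : (a : ℕ) < b := hab
  unfold beads
  omega

/-- The place among `0, …, r - 1` that the Maya diagram of `λ` leaves free because of the
`i`-th leg. -/
def legPos {r : ℕ} {lam : YoungDiagram} (hr : lam.colLen 0 ≤ r) (i : Fin (diagLength lam)) :
    Fin r :=
  ⟨r - 1 - leg lam i, by have := leg_lt hr i.isLt; omega⟩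

theorem legPos_strictMono {r : ℕ} {lam : YoungDiagram} (hr : lam.colLen 0 ≤ r) :
    StrictMono (legPos hr) := by
  intro i j hij
  have h1 := leg_lt_leg hij j.isLt
  have h2 := leg_lt hr i.isLt
  rw [Fin.lt_def]
  simp only [legPos]
  omega

theorem sub_legPos {r : ℕ} {lam : YoungDiagram} (hr : lam.colLen 0 ≤ r)
    (i : Fin (diagLength lam)) : r - 1 - (legPos hr i : ℕ) = leg lam i := by
  have h2 := leg_lt hr i.isLt
  simp only [legPos]
  omega

/-- The place of the bead that belongs to the `i`-th arm of `λ`. -/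
def armPos (r : ℕ) (lam : YoungDiagram) (i : Fin (diagLength lam)) : ℕ := r + arm lam i

theorem armPos_strictAnti (r : ℕ) (lam : YoungDiagram) : StrictAnti (armPos r lam) :=
  fun _ j hij => Nat.add_lt_add_left (arm_lt_arm hij j.isLt) r

/-- The Maya diagram of `λ`, arranged such that every bead that has not been moved is at its own
place. -/
noncomputable def movedBeads {r : ℕ} {lam : YoungDiagram} (hr : lam.colLen 0 ≤ r) : Fin r → ℕ :=
  Function.extend (legPos hr) (armPos r lam) Fin.val

theorem movedBeads_injective {r : ℕ} {lam : YoungDiagram} (hr : lam.colLen 0 ≤ r) :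
    (movedBeads hr).Injective := by
  have hR := (legPos_strictMono hr).injective
  have hT := (armPos_strictAnti r lam).injective
  intro a b hab
  unfold movedBeads at hab
  by_cases ha : ∃ i, legPos hr i = a <;> by_cases hb : ∃ i, legPos hr i = b
  · obtain ⟨i, rfl⟩ := ha
    obtain ⟨j, rfl⟩ := hb
    rw [hR.extend_apply, hR.extend_apply] at hab
    rw [hT hab]
  · obtain ⟨i, rfl⟩ := ha
    rw [hR.extend_apply, Function.extend_apply' _ _ _ hb, armPos] at hab
    omega
  · obtain ⟨j, rfl⟩ := hb
    rw [hR.extend_apply, Function.extend_apply' _ _ _ ha, armPos] at hab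
    omega
  · rw [Function.extend_apply' _ _ _ ha, Function.extend_apply' _ _ _ hb] at hab
    exact Fin.ext hab

/-- A filled place r+α_i is the bead of row i. For an untouched place k, put b = r-1-k; a row b+j of
length exactly j has its bead at k. Such a row exists because no leg equals b. -/
theorem movedBeads_mem_range {r : ℕ} {lam : YoungDiagram} (hr : lam.colLen 0 ≤ r) (k : Fin r) :
    movedBeads hr k ∈ Set.range (beads r lam) := by
  classical
  unfold movedBeads
  by_cases hk : ∃ i, legPos hr i = k
  · obtain ⟨i, rfl⟩ := hk
    rw [(legPos_strictMono hr).injective.extend_apply]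
    have h1 := lt_rowLen_of_lt_diagLength i.isLt
    have h2 := lt_colLen_of_lt_diagLength i.isLt
    have h3 := lam.colLen_anti 0 i (Nat.zero_le _)
    refine ⟨Fin.rev ⟨i, by omega⟩, ?_⟩
    simp only [beads, armPos, arm, Fin.rev_rev, Fin.val_rev]
    omega
  · rw [Function.extend_apply' _ _ _ hk]
    have hk0 := k.isLt
    obtain ⟨b, hb⟩ : ∃ b, b = r - 1 - (k : ℕ) := ⟨_, rfl⟩
    -- The least such j works: column j ends at or above row b+j, and column j-1 must reach past it.
    have hex : ∃ j, lam.colLen j ≤ b + j := by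
      refine ⟨lam.rowLen 0, ?_⟩
      have : ¬ 0 < lam.colLen (lam.rowLen 0) := by
        rw [← YoungDiagram.mem_iff_lt_colLen, YoungDiagram.mem_iff_lt_rowLen]
        exact lt_irrefl _
      omega
    have hj := Nat.find_spec hex
    have hmin : ∀ j' < Nat.find hex, b + j' < lam.colLen j' := fun j' h =>
      not_le.1 (Nat.find_min hex h)
    generalize Nat.find hex = j at hj hmin
    -- Equality would make column j' have leg b, so that k would be a vacated place.
    have hstrict : ∀ j' < j, b + 1 + j' < lam.colLen j' := by
      intro j' h
      refine lt_of_le_of_ne (by have := hmin j' h; omega) fun heq => hk ?_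
      have hd : j' < diagLength lam := by
        rw [lt_diagLength_iff, YoungDiagram.mem_iff_lt_colLen]
        omega
      refine ⟨⟨j', hd⟩, Fin.ext ?_⟩
      simp only [legPos, leg]
      omega
    have hrow : lam.rowLen (b + j) = j := by
      apply le_antisymm
      · rw [← not_lt, ← YoungDiagram.mem_iff_lt_rowLen, YoungDiagram.mem_iff_lt_colLen]
        omega
      · rcases Nat.eq_zero_or_pos j with h | h
        · omega
        · have h1 : (b + j, j - 1) ∈ lam := by
            rw [YoungDiagram.mem_iff_lt_colLen]
            have := hstrict (j - 1) (by omega)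
            omega
          have := YoungDiagram.mem_iff_lt_rowLen.1 h1
          omega
    have hlt : b + j < r := by
      rcases Nat.eq_zero_or_pos j with h | h
      · omega
      · have h1 := hstrict (j - 1) (by omega)
        have h2 := lam.colLen_anti 0 (j - 1) (Nat.zero_le _)
        omega
    refine ⟨Fin.rev ⟨b + j, hlt⟩, ?_⟩
    simp only [beads, Fin.rev_rev, Fin.val_rev, hrow]
    omega

/-- The bead moved to the place r-1-β_i jumps over the β_i places after it, whence its sign. -/
theorem det_submatrix_beads {K : Type*} [CommRing K] {r : ℕ} (G : Matrix (Fin r) ℕ K)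
    {lam : YoungDiagram} (hr : lam.colLen 0 ≤ r) :
    (G.submatrix id (beads r lam)).det =
      (∏ i : Fin (diagLength lam), (-1) ^ leg lam i) * (G.submatrix id (movedBeads hr)).det := by
  rw [det_submatrix_rearrange G (beads_strictMono r lam) (movedBeads_injective hr)
    (movedBeads_mem_range hr)]
  unfold movedBeads
  rw [prod_inversions_extend (legPos_strictMono hr) (armPos_strictAnti r lam)
    fun i => Nat.le_add_right _ _]
  simp only [sub_legPos]

end Frobenius

/-! ### The skew minor as a block determinant. -/

section Unitriangular

variable {K : Type*} [Field K] {u : Matrix ℕ ℕ K}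

/-- The leading `r × r` block. -/
def leading (u : Matrix ℕ ℕ K) (r : ℕ) : Matrix (Fin r) (Fin r) K := u.submatrix Fin.val Fin.val

theorem leading_blockTriangular (h0 : ∀ i j, j < i → u i j = 0) (r : ℕ) :
    (leading u r).BlockTriangular id :=
  fun i j hij => h0 i j hij

theorem det_leading (h0 : ∀ i j, j < i → u i j = 0) (h1 : ∀ i, u i i = 1) (r : ℕ) :
    (leading u r).det = 1 := by
  rw [det_of_isUpperTriangular (leading_blockTriangular h0 r)]
  simp [leading, h1]

theorem inv_leading_apply_of_lt (h0 : ∀ i j, j < i → u i j = 0) (h1 : ∀ i, u i i = 1) {r : ℕ}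
    {i j : Fin r} (hij : j < i) : (leading u r)⁻¹ i j = 0 := by
  let := (leading u r).invertibleOfIsUnitDet (by simp [det_leading h0 h1])
  exact blockTriangular_inv_of_blockTriangular (leading_blockTriangular h0 r) hij

/-- A skew minor in terms of the Frobenius coordinates of both partitions. -/
theorem det_submatrix_beads_beads (h0 : ∀ i j, j < i → u i j = 0) (h1 : ∀ i, u i i = 1) {r : ℕ}
    {lam mu : YoungDiagram} (hl : lam.colLen 0 ≤ r) (hm : mu.colLen 0 ≤ r) :
    (u.submatrix (beads r mu) (beads r lam)).det =
      (∏ i : Fin (diagLength lam), (-1) ^ leg lam i) *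
      (∏ i : Fin (diagLength mu), (-1) ^ leg mu i) * ((-1) ^ diagLength mu *
      (fromBlocks
        (((leading u r)⁻¹ * u.submatrix (Fin.val : Fin r → ℕ) (armPos r lam)).submatrix
          (legPos hl) id)
        ((leading u r)⁻¹.submatrix (legPos hl) (legPos hm))
        (u.submatrix (armPos r mu) (armPos r lam)) 0).det) := by
  have e1 := det_submatrix_beads (u.submatrix (beads r mu) id) hl
  -- The rows are rearranged as columns of the transpose, with the columns already in their new
  -- order.
  have e2 := det_submatrix_beads (uᵀ.submatrix (movedBeads hl) id) hm
  rw [submatrix_submatrix] at e1 e2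
  rw [submatrix_submatrix] at e1 e2
  simp only [Function.comp_id, Function.id_comp] at e1 e2
  rw [← transpose_submatrix, ← transpose_submatrix, det_transpose, det_transpose] at e2
  rw [e1, e2]
  unfold movedBeads
  have hA : (u.submatrix Fin.val Fin.val : Matrix (Fin r) (Fin r) K).det = 1 := det_leading h0 h1 r
  rw [det_submatrix_extend u Fin.val (by rw [hA]; exact isUnit_one)
    (legPos_strictMono hl).injective (armPos r lam) (legPos_strictMono hm).injective (armPos r mu),
    hA, Fintype.card_fin, one_mul, mul_assoc]
  · rfl
  -- A new row has index at least `r`, hence lies below the diagonal in the columns of the leading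
  -- block.
  · ext i j
    exact h0 _ _ (j.isLt.trans_le (Nat.le_add_right _ _))

end Unitriangular

/-! ### Row and column lengths of hooks, rows and columns. -/

section Shapes

theorem rowLen_eq {lam : YoungDiagram} {i n : ℕ} (h : ∀ j, (i, j) ∈ lam ↔ j < n) :
    lam.rowLen i = n :=
  eq_of_forall_lt_iff fun j => by rw [← YoungDiagram.mem_iff_lt_rowLen, h]

theorem colLen_eq {lam : YoungDiagram} {j n : ℕ} (h : ∀ i, (i, j) ∈ lam ↔ i < n) :
    lam.colLen j = n :=
  eq_of_forall_lt_iff fun i => by rw [← YoungDiagram.mem_iff_lt_colLen, h]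

theorem InRectangle.mono {lam mu : YoungDiagram} {r s : ℕ} (h : InRectangle lam r s)
    (hmu : mu ≤ lam) : InRectangle mu r s := by
  constructor
  · refine le_trans (le_of_forall_lt fun i hi => ?_) h.1
    rw [← YoungDiagram.mem_iff_lt_colLen] at hi ⊢
    exact hmu hi
  · refine le_trans (le_of_forall_lt fun i hi => ?_) h.2
    rw [← YoungDiagram.mem_iff_lt_rowLen] at hi ⊢
    exact hmu hi

theorem rowLen_bot (i : ℕ) : (⊥ : YoungDiagram).rowLen i = 0 :=
  rowLen_eq fun j => by simp [YoungDiagram.notMem_bot]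

theorem colLen_bot (i : ℕ) : (⊥ : YoungDiagram).colLen i = 0 :=
  colLen_eq fun j => by simp [YoungDiagram.notMem_bot]

theorem inRectangle_bot (r s : ℕ) : InRectangle ⊥ r s := by
  simp [InRectangle, rowLen_bot, colLen_bot]

theorem beads_bot (r : ℕ) : beads r ⊥ = Fin.val := by
  ext a
  simp [beads, rowLen_bot]

theorem diagLength_bot : diagLength ⊥ = 0 := by
  simp [diagLength]

theorem mem_hook {a b : ℕ} {i j : ℕ} : (i, j) ∈ hook a b ↔ i = 0 ∧ j ≤ a ∨ j = 0 ∧ i ≤ b := by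
  rw [hook, YoungDiagram.mem_ofRowLens]
  rcases i with _ | i
  · simp
    omega
  · simp
    omega

theorem rowLen_hook_zero (a b : ℕ) : (hook a b).rowLen 0 = a + 1 :=
  rowLen_eq fun j => by rw [mem_hook]; omega

theorem colLen_hook_zero (a b : ℕ) : (hook a b).colLen 0 = b + 1 :=
  colLen_eq fun j => by rw [mem_hook]; omega

theorem diagLength_hook (a b : ℕ) : diagLength (hook a b) = 1 :=
  eq_of_forall_lt_iff fun i => by rw [lt_diagLength_iff, mem_hook]; omega

theorem rowLen_oneRow (d i : ℕ) : (oneRow d).rowLen i = if i = 0 then d else 0 :=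
  rowLen_eq fun j => by
    rw [oneRow, YoungDiagram.mem_ofRowLens]
    rcases i with _ | i <;> simp

theorem colLen_oneRow_le (d : ℕ) : (oneRow d).colLen 0 ≤ 1 := by
  rw [← not_lt, ← YoungDiagram.mem_iff_lt_colLen, YoungDiagram.mem_iff_lt_rowLen, rowLen_oneRow]
  simp

theorem oneColumn_zero : oneColumn 0 = ⊥ := by
  ext ⟨i, j⟩
  simp [oneColumn, YoungDiagram.mem_ofRowLens]

theorem oneColumn_succ (d : ℕ) : oneColumn (d + 1) = hook 0 d := rfl

theorem inRectangle_oneColumn {d r s : ℕ} (hd : d ≤ r) (hs : 1 ≤ s) :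
    InRectangle (oneColumn d) r s := by
  rcases d with _ | d
  · rw [oneColumn_zero]
    exact inRectangle_bot r s
  · rw [oneColumn_succ, InRectangle, colLen_hook_zero, rowLen_hook_zero]
    omega

end Shapes

/-! ### Hooks, rows and columns as matrix entries. -/

section SpecialMinors

variable {K : Type*} [Field K] {u : Matrix ℕ ℕ K}

/-- A hook against the empty partition has one arm and one leg, so the block determinant is a single
entry. -/
theorem det_beads_hook (h0 : ∀ i j, j < i → u i j = 0) (h1 : ∀ i, u i i = 1) {r a b : ℕ}
    (hb : b < r) :
    (u.submatrix (beads r ⊥) (beads r (hook a b))).det =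
      (-1) ^ b * ((leading u r)⁻¹ *ᵥ fun k => u k (r + a)) ⟨r - 1 - b, by omega⟩ := by
  have hl : (hook a b).colLen 0 ≤ r := by rw [colLen_hook_zero]; omega
  have hm : (⊥ : YoungDiagram).colLen 0 ≤ r := by rw [colLen_bot]; omega
  have hd := diagLength_hook a b
  have : IsEmpty (Fin (diagLength ⊥)) := by rw [diagLength_bot]; infer_instance
  let : Unique (Fin (diagLength (hook a b))) :=
    ⟨⟨⟨0, by omega⟩⟩, fun i => Fin.ext (by have := i.isLt; change (i : ℕ) = 0; omega)⟩
  let : Unique (Fin (diagLength (hook a b)) ⊕ Fin (diagLength ⊥)) :=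
    ⟨⟨Sum.inl default⟩, by
      rintro (i | i)
      · exact congrArg Sum.inl (Unique.eq_default i)
      · exact isEmptyElim i⟩
  have hdef : ((default : Fin (diagLength (hook a b))) : ℕ) = 0 := rfl
  have hleg : leg (hook a b) 0 = b := by simp [leg, colLen_hook_zero]
  have harm : arm (hook a b) 0 = a := by simp [arm, rowLen_hook_zero]
  rw [det_submatrix_beads_beads h0 h1 hl hm, det_unique, Fintype.prod_unique, Fintype.prod_empty,
    hdef, hleg, mul_one]
  have hpow : (-1 : K) ^ diagLength ⊥ = 1 := by rw [diagLength_bot, pow_zero]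
  rw [hpow, one_mul]
  congr 1
  change (((leading u r)⁻¹ * u.submatrix (Fin.val : Fin r → ℕ) (armPos r (hook a b)))
    (legPos hl default) default) = _
  have hpos : legPos hl default = ⟨r - 1 - b, by omega⟩ := by
    apply Fin.ext
    simp only [legPos, hdef, hleg]
  rw [hpos, mul_apply, mulVec, dotProduct]
  simp only [submatrix_apply, armPos, hdef, harm]

/-- Only the last bead moves, so the minor is triangular with all diagonal entries 1 except the
last. -/
theorem det_beads_oneRow (h0 : ∀ i j, j < i → u i j = 0) (h1 : ∀ i, u i i = 1) (n d : ℕ) :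
    (u.submatrix (beads (n + 1) ⊥) (beads (n + 1) (oneRow d))).det = u n (n + d) := by
  have hval : ∀ i : Fin n, beads (n + 1) (oneRow d) i.castSucc = i := by
    intro i
    have : n - (i : ℕ) ≠ 0 := by omega
    simp [beads, rowLen_oneRow, Fin.val_rev, this]
  have hlast : beads (n + 1) (oneRow d) (Fin.last n) = n + d := by
    simp [beads, rowLen_oneRow, add_comm]
  rw [beads_bot, det_of_isUpperTriangular]
  · rw [Fin.prod_univ_castSucc]
    simp [hval, hlast, h1]
  · intro i j hij
    have hij' : (j : ℕ) < i := hij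
    induction j using Fin.lastCases with
    | last => exact absurd hij' (by have := i.isLt; simp; omega)
    | cast j =>
      rw [submatrix_apply, hval]
      exact h0 _ _ hij'

/-- Column n of the product of the block with its inverse, cut off after index n because the inverse
is upper triangular. -/
theorem sum_mul_inv_leading (h0 : ∀ i j, j < i → u i j = 0) (h1 : ∀ i, u i i = 1) {n r : ℕ}
    (hn : n < r) (l : Fin r) :
    (∑ m : Fin n, u l m * (leading u r)⁻¹ ⟨m, m.isLt.trans hn⟩ ⟨n, hn⟩) +
      u l n * (leading u r)⁻¹ ⟨n, hn⟩ ⟨n, hn⟩ = if (l : ℕ) = n then 1 else 0 := by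
  have h := congrFun (congrFun (mul_nonsing_inv (leading u r)
    (by simp [det_leading h0 h1])) l) ⟨n, hn⟩
  rw [mul_apply, one_apply] at h
  simp only [Fin.ext_iff] at h
  rw [← h]
  obtain ⟨t, rfl⟩ : ∃ t, r = n + 1 + t := ⟨r - (n + 1), by omega⟩
  rw [Fin.sum_univ_add, Fin.sum_univ_castSucc]
  have hz : ∀ i : Fin t, (leading u (n + 1 + t))⁻¹ (Fin.natAdd (n + 1) i) ⟨n, hn⟩ = 0 := by
    intro i
    apply inv_leading_apply_of_lt h0 h1
    rw [Fin.lt_def]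
    simp
    omega
  simp only [hz, mul_zero, Finset.sum_const_zero, add_zero]
  rfl

theorem inv_leading_diag (h0 : ∀ i j, j < i → u i j = 0) (h1 : ∀ i, u i i = 1) {n r : ℕ}
    (hn : n < r) : (leading u r)⁻¹ ⟨n, hn⟩ ⟨n, hn⟩ = 1 := by
  have h := sum_mul_inv_leading h0 h1 hn ⟨n, hn⟩
  rw [Finset.sum_eq_zero fun m _ => by rw [h0 _ _ m.isLt, zero_mul]] at h
  simpa [h1] using h

/-- Block inversion of a triangular matrix. It lets the e's for varying numbers n of beads all be
read off the inverse of one r × r block. -/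
theorem inv_leading_mulVec (h0 : ∀ i j, j < i → u i j = 0) (h1 : ∀ i, u i i = 1) {n r : ℕ}
    (hn : n < r) (k : Fin n) :
    ((leading u n)⁻¹ *ᵥ fun l => u l n) k =
      -(leading u r)⁻¹ ⟨k, k.isLt.trans hn⟩ ⟨n, hn⟩ := by
  have hx : (leading u n) *ᵥ (fun m : Fin n => -(leading u r)⁻¹ ⟨m, m.isLt.trans hn⟩ ⟨n, hn⟩) =
      fun l : Fin n => u l n := by
    ext l
    have h := sum_mul_inv_leading h0 h1 hn ⟨l, l.isLt.trans hn⟩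
    rw [inv_leading_diag h0 h1, if_neg l.isLt.ne, mul_one] at h
    simp only [mulVec, dotProduct, mul_neg, Finset.sum_neg_distrib]
    rw [neg_eq_iff_add_eq_zero]
    exact h
  rw [← hx, mulVec_mulVec, nonsing_inv_mul _ (by simp [det_leading h0 h1]), one_mulVec]

/-- A nonempty column is a hook with arm 0, so its entry involves column n of U, which
`inv_leading_mulVec` converts; the minus sign there accounts for the extra box. -/
theorem det_beads_oneColumn (h0 : ∀ i j, j < i → u i j = 0) (h1 : ∀ i, u i i = 1) {n r d : ℕ}
    (hn : n < r) (hd : d ≤ n) :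
    (u.submatrix (beads n ⊥) (beads n (oneColumn d))).det =
      (-1) ^ d * (leading u r)⁻¹ ⟨n - d, by omega⟩ ⟨n, hn⟩ := by
  rcases d with _ | d
  · have := det_leading h0 h1 n
    rw [oneColumn_zero, beads_bot]
    rw [leading] at this
    simpa [inv_leading_diag h0 h1] using this
  · rw [oneColumn_succ, det_beads_hook h0 h1 (by omega)]
    simp only [Nat.add_zero]
    rw [inv_leading_mulVec h0 h1 hn]
    have : n - 1 - d = n - (d + 1) := by omega
    simp only [this]
    ring

end SpecialMinors

/-! ### The Giambelli blocks of the generic matrix. -/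

section Generic

/-- The upper unitriangular Gauss factor, continued by the identity matrix. -/
noncomputable def extendedFactor (N : ℕ) : Matrix ℕ ℕ (RatFun N) :=
  Matrix.of fun i j => if h : i < N ∧ j < N then upperFactor N ⟨i, h.1⟩ ⟨j, h.2⟩
    else if i = j then 1 else 0

theorem isUpperUnitriangular_upperFactor (N : ℕ) : IsUpperUnitriangular (upperFactor N) := by
  obtain ⟨L, d, h⟩ := (eq_upperFactor_iff N (upperFactor N)).1 rfl
  exact h.2.1

theorem extendedFactor_of_lt (N i j : ℕ) (hij : j < i) : extendedFactor N i j = 0 := by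
  rw [extendedFactor, of_apply]
  split_ifs with h h'
  · exact (isUpperUnitriangular_upperFactor N).1 _ _ hij
  · omega
  · rfl

theorem extendedFactor_diag (N i : ℕ) : extendedFactor N i i = 1 := by
  rw [extendedFactor, of_apply]
  split_ifs with h
  · exact (isUpperUnitriangular_upperFactor N).2 _
  · rfl
  · exact absurd rfl ‹_›

theorem schur_eq_det {N r : ℕ} {lam mu : YoungDiagram} (hr : r ≤ N)
    (hlam : InRectangle lam r (N - r)) (hmu : InRectangle mu r (N - r)) :
    schur N r lam mu = ((extendedFactor N).submatrix (beads r mu) (beads r lam)).det := by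
  rw [schur, dif_pos ⟨⟨hr, hlam⟩, ⟨hr, hmu⟩⟩]
  congr 1
  ext a b
  rw [submatrix_apply, submatrix_apply, extendedFactor, of_apply,
    dif_pos ⟨(maya N r mu ⟨hr, hmu⟩ a).isLt, (maya N r lam ⟨hr, hlam⟩ b).isLt⟩]
  rfl

theorem schur_hook {N r a b : ℕ} (ha : r + a < N) (hb : b < r) :
    schur N r (hook a b) ⊥ = (-1) ^ b *
      ((leading (extendedFactor N) r)⁻¹ *ᵥ fun k => extendedFactor N k (r + a))
        ⟨r - 1 - b, by omega⟩ := by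
  rw [schur_eq_det (by omega) _ (inRectangle_bot _ _),
    det_beads_hook (extendedFactor_of_lt N) (extendedFactor_diag N) hb]
  rw [InRectangle, colLen_hook_zero, rowLen_hook_zero]
  omega

theorem hFun_eq {N r a c : ℕ} (ha : r + a < N) (hc : r + c < N) :
    hFun N (r + c + 1) ((a : ℤ) - c) = extendedFactor N (r + c) (r + a) := by
  rw [hFun]
  split_ifs with h
  -- The convention h_d = 0 for d < 0 matches the zeros of U below the diagonal.
  · exact (extendedFactor_of_lt N _ _ (by omega)).symm
  · obtain ⟨d, rfl⟩ : ∃ d, a = c + d := ⟨a - c, by omega⟩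
    have : (((c + d : ℕ) : ℤ) - c).toNat = d := by omega
    rw [this, schur_eq_det (by omega) _ (inRectangle_bot _ _),
      det_beads_oneRow (extendedFactor_of_lt N) (extendedFactor_diag N), add_assoc r c d]
    refine ⟨(colLen_oneRow_le d).trans (by omega), ?_⟩
    rw [rowLen_oneRow, if_pos rfl]
    omega

theorem eFun_eq {N r b d : ℕ} (hr : r ≤ N) (hb : b < r) (hd : d < r) :
    eFun N (r - (d + 1)) ((b : ℤ) - d) = (-1) ^ b *
      (leading (extendedFactor N) r)⁻¹ ⟨r - 1 - b, by omega⟩ ⟨r - 1 - d, by omega⟩ * (-1) ^ d := by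
  rw [eFun]
  split_ifs with h
  -- Likewise e_d = 0 for d < 0 matches the zeros of the inverse below its diagonal.
  · rw [inv_leading_apply_of_lt (extendedFactor_of_lt N) (extendedFactor_diag N)
      (by rw [Fin.lt_def]; simp only; omega)]
    simp
  · obtain ⟨c, rfl⟩ : ∃ c, b = d + c := ⟨b - d, by omega⟩
    have e1 : (((d + c : ℕ) : ℤ) - d).toNat = c := by omega
    have e2 : r - (d + 1) = r - 1 - d := by omega
    have e3 : r - 1 - d - c = r - 1 - (d + c) := by omega
    rw [e1, e2, schur_eq_det (by omega) (inRectangle_oneColumn (by omega) (by omega))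
      (inRectangle_bot _ _), det_beads_oneColumn (extendedFactor_of_lt N) (extendedFactor_diag N)
      (show r - 1 - d < r by omega) (by omega)]
    simp only [e3]
    rw [pow_add, mul_right_comm, mul_right_comm ((-1) ^ d), ← mul_pow]
    simp

/-- The rows of the Giambelli matrix are indexed by arms of λ, those of the minor formula by legs.
After transposing, the signs factor out as diagonal matrices on both sides. -/
theorem det_giambelliMatrix {N r : ℕ} {lam mu : YoungDiagram} (hr : r ≤ N)
    (hlam : InRectangle lam r (N - r)) (hmu : InRectangle mu r (N - r)) :
    (giambelliMatrix N r lam mu).det =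
      (∏ i : Fin (diagLength lam), (-1) ^ leg lam i) *
      (∏ i : Fin (diagLength mu), (-1) ^ leg mu i) *
      (fromBlocks
        (((leading (extendedFactor N) r)⁻¹ *
          (extendedFactor N).submatrix (Fin.val : Fin r → ℕ) (armPos r lam)).submatrix
            (legPos hlam.1) id)
        ((leading (extendedFactor N) r)⁻¹.submatrix (legPos hlam.1) (legPos hmu.1))
        ((extendedFactor N).submatrix (armPos r mu) (armPos r lam)) 0).det := by
  have key : (giambelliMatrix N r lam mu)ᵀ =
      fromBlocks (diagonal fun i : Fin (diagLength lam) => (-1) ^ leg lam i) 0 0 1 *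
      fromBlocks
        (((leading (extendedFactor N) r)⁻¹ *
          (extendedFactor N).submatrix (Fin.val : Fin r → ℕ) (armPos r lam)).submatrix
            (legPos hlam.1) id)
        ((leading (extendedFactor N) r)⁻¹.submatrix (legPos hlam.1) (legPos hmu.1))
        ((extendedFactor N).submatrix (armPos r mu) (armPos r lam)) 0 *
      fromBlocks 1 0 0 (diagonal fun i : Fin (diagLength mu) => (-1) ^ leg mu i) := by
    rw [giambelliMatrix, fromBlocks_transpose, fromBlocks_multiply, fromBlocks_multiply]
    simp only [Matrix.zero_mul, Matrix.mul_zero, add_zero, zero_add, Matrix.mul_one,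
      Matrix.one_mul, transpose_zero]
    congr 1
    · ext i j
      rw [transpose_apply, of_apply, schur_hook _ (leg_lt hlam.1 i.isLt), diagonal_mul]
      · rfl
      · have := arm_lt hlam.2 j.isLt
        omega
    · ext i j
      rw [transpose_apply, of_apply, eFun_eq hr (leg_lt hlam.1 i.isLt) (leg_lt hmu.1 j.isLt),
        mul_diagonal, diagonal_mul]
      rfl
    · ext i j
      have h1 := arm_lt hlam.2 j.isLt
      have h2 := arm_lt hmu.2 i.isLt
      rw [transpose_apply, of_apply, hFun_eq (by omega) (by omega)]
      rfl
  rw [← det_transpose, key, det_mul, det_mul, det_fromBlocks_zero₂₁, det_fromBlocks_zero₂₁,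
    det_diagonal, det_diagonal, det_one, det_one]
  ring

end Generic

end NinthSchur

theorem mainTheorem2 (r s : ℕ) (lam mu : YoungDiagram)
    (hlam : NinthSchur.InRectangle lam r s) (hmu : mu ≤ lam) :
    NinthSchur.schur (r + s) r lam mu =
      (-1) ^ NinthSchur.diagLength mu *
        (NinthSchur.giambelliMatrix (r + s) r lam mu).det := by
  have hl : NinthSchur.InRectangle lam r (r + s - r) := by rwa [Nat.add_sub_cancel_left]
  have hm := hl.mono hmu
  rw [NinthSchur.schur_eq_det (Nat.le_add_right r s) hl hm,
    NinthSchur.det_giambelliMatrix (Nat.le_add_right r s) hl hm,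
    NinthSchur.det_submatrix_beads_beads (NinthSchur.extendedFactor_of_lt _)
      (NinthSchur.extendedFactor_diag _) hl.1 hm.1]
  ring
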